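/- Let $\Gamma$ be a countably infinite connected graph with symmetric weights $\mu_{x,y}=\mu_{y,x}\ge 0$, where $\mu_{x,y}>0$ exactly when $x\sim y$ (loops are allowed), such that $\mu(x)=\sum_{y}\mu_{x,y}<\infty$ for every vertex $x$. Let $(X_n)$ be the random walk with transition probabilities $P(x,y)=\mu_{x,y}/\mu(x)$, let $d$ be the graph distance, $B(x,R)=\{y: d(x,y)<R\}$, $V(x,R)=\sum_{y\in B(x,R)}\mu(y)$, let $T_A=\min\{k: X_k\notin A\}$ be the exit time from $A$, and put $E(x,R)=\mathbb{E}(T_{B(x,R)}\mid X_0=x)$ and $F(R)=\inf_{x\in\Gamma}E(x,R)$. Suppose that the following conditions hold. $(p_0)$: there is $p_0>0$ such that $P(x,y)\ge p_0$ whenever $x\sim y$. $(VD)$: there is $D_V>0$ such that $V(x,2R)\le D_V V(x,R)$ for all $x\in\Gamma$ and all real $R>0$. $(E)$: there is $C>1$ such that $E(x,R)\le C\,E(y,R)$ for all $x,y\in\Gamma$ and all real $R>0$. $(H)$: there is $H>1$ such that for all $x\in\Gamma$, all real $R>0$ and every function $u$ that is non-negative on $B(x,2R)$ and on all neighbours of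 its points and is harmonic in $B(x,2R)$ (that is, $\sum_y P(z,y)u(y)=u(z)$ for all $z\in B(x,2R)$), one has $\max_{B(x,R)}u\le H\min_{B(x,R)}u$. Then $F$ has the strong anti-doubling property: there are constants $B_F>A_F>1$ such that $F(A_F R)\ge B_F F(R)$ for all real $R\ge 1$. Moreover, for integer radii one can take $A_F=3$: there is a constant $B_F>3$ such that $F(3R)\ge B_F F(R)$ for all integers $R\ge 1$. -/

import Mathlib

open MeasureTheory ProbabilityTheory
open scoped ENNReal

/-- A connected weighted graph on the vertex set `V`: a symmetric non-negative weight function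
with finite vertex sums; `x ∼ y` is an edge exactly when `0 < weight x y` (loops are allowed, and
`SimpleGraph.fromRel` drops them, which changes neither connectedness nor distances). -/
structure WeightedGraph (V : Type*) where
  weight : V → V → ℝ
  symm : ∀ x y, weight x y = weight y x
  nonneg : ∀ x y, 0 ≤ weight x y
  summable : ∀ x, Summable (weight x)
  connected : (SimpleGraph.fromRel fun x y => 0 < weight x y).Connected

namespace WeightedGraph

/-- The adjacency relation `x ∼ y`. -/
def Adj {V : Type*} (Γ : WeightedGraph V) (x y : V) : Prop := 0 < Γ.weight x y

/-- The underlying graph, without its loops. -/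
def graph {V : Type*} (Γ : WeightedGraph V) : SimpleGraph V :=
  SimpleGraph.fromRel fun x y => 0 < Γ.weight x y

/-- The vertex measure `μ(x) = ∑_{y ∼ x} μ_{x,y}`. -/
noncomputable def mass {V : Type*} (Γ : WeightedGraph V) (x : V) : ℝ := ∑' y, Γ.weight x y

/-- The transition probability `P(x,y) = μ_{x,y} / μ(x)`. -/
noncomputable def P {V : Type*} (Γ : WeightedGraph V) (x y : V) : ℝ := Γ.weight x y / Γ.mass x

theorem mass_pos {V : Type*} [Nontrivial V] (Γ : WeightedGraph V) (x : V) : 0 < Γ.mass x := by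
  obtain ⟨y, hy⟩ := Γ.connected.preconnected.exists_adj_of_nontrivial x
  have h : 0 < Γ.weight x y := by
    rcases ((SimpleGraph.fromRel_adj _ _ _).1 hy).2 with h | h
    · exact h
    · rw [Γ.symm]; exact h
  exact (Γ.summable x).tsum_pos (Γ.nonneg x) y h

theorem P_nonneg {V : Type*} (Γ : WeightedGraph V) (x y : V) : 0 ≤ Γ.P x y :=
  div_nonneg (Γ.nonneg x y) (tsum_nonneg (Γ.nonneg x))

theorem hasSum_P {V : Type*} [Nontrivial V] (Γ : WeightedGraph V) (x : V) :
    HasSum (Γ.P x) 1 := by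
  have h := (Γ.summable x).hasSum.div_const (Γ.mass x)
  have e : (∑' y, Γ.weight x y) / Γ.mass x = 1 := div_self (Γ.mass_pos x).ne'
  rw [e] at h
  exact h

/-- The one-step distribution `P(x, ·)`. -/
noncomputable def stepPMF {V : Type*} [Nontrivial V] (Γ : WeightedGraph V) (x : V) : PMF V :=
  ⟨fun y => ENNReal.ofReal (Γ.P x y), by
    have h := ENNReal.ofReal_tsum_of_nonneg (Γ.P_nonneg x) (Γ.hasSum_P x).summable
    rw [(Γ.hasSum_P x).tsum_eq, ENNReal.ofReal_one] at h
    rw [h]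
    exact ENNReal.summable.hasSum⟩

/-- The Markov kernel that moves the walk from its position `X_n` to `X_{n+1}`. -/
noncomputable def stepKernel {V : Type*} [Nontrivial V] [MeasurableSpace V]
    [DiscreteMeasurableSpace V] (Γ : WeightedGraph V) (n : ℕ) :
    Kernel (∀ _ : Finset.Iic n, V) V where
  toFun h := (Γ.stepPMF (h ⟨n, Finset.mem_Iic.2 le_rfl⟩)).toMeasure
  measurable' := (Measurable.of_discrete (f := fun x : V => (Γ.stepPMF x).toMeasure)).comp
    (measurable_pi_apply _)

instance {V : Type*} [Nontrivial V] [MeasurableSpace V] [DiscreteMeasurableSpace V]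
    (Γ : WeightedGraph V) (n : ℕ) : IsMarkovKernel (Γ.stepKernel n) :=
  ⟨fun _ => PMF.toMeasure.isProbabilityMeasure _⟩

/-- The law on the space of paths `ℕ → V` of the random walk `X_0, X_1, …` with transition
probabilities `P` started at `X_0 = z`. -/
noncomputable def walkLaw {V : Type*} [Nontrivial V] [MeasurableSpace V]
    [DiscreteMeasurableSpace V] (Γ : WeightedGraph V) (z : V) : Measure (ℕ → V) :=
  Kernel.trajMeasure (X := fun _ => V) (Measure.dirac z) Γ.stepKernel

/-- The exit time `T_A = min {k : X_k ∉ A}` of a path, `∞` if the path stays in `A`. -/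
noncomputable def exitTime {V : Type*} (A : Set V) (ω : ℕ → V) : ℕ∞ :=
  ⨅ (k : ℕ) (_ : ω k ∉ A), (k : ℕ∞)

/-- `E_z(A)`, the expectation of `T_A` for the walk started at `z`. -/
noncomputable def meanExit {V : Type*} [Nontrivial V] [MeasurableSpace V]
    [DiscreteMeasurableSpace V] (Γ : WeightedGraph V) (z : V) (A : Set V) : ℝ≥0∞ :=
  ∫⁻ ω, (exitTime A ω : ℝ≥0∞) ∂(Γ.walkLaw z)

/-- The open ball `B(x,R)` of the graph distance. -/
def ball {V : Type*} (Γ : WeightedGraph V) (x : V) (R : ℝ) : Set V :=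
  {y | (Γ.graph.dist x y : ℝ) < R}

/-- `V(x,R) = μ(B(x,R))`. -/
noncomputable def vol {V : Type*} (Γ : WeightedGraph V) (x : V) (R : ℝ) : ℝ≥0∞ :=
  ∑' y : Γ.ball x R, ENNReal.ofReal (Γ.mass y)

/-- `E(x,R)`, the mean exit time from `B(x,R)` for the walk started at the centre. -/
noncomputable def E {V : Type*} [Nontrivial V] [MeasurableSpace V]
    [DiscreteMeasurableSpace V] (Γ : WeightedGraph V) (x : V) (R : ℝ) : ℝ≥0∞ :=
  Γ.meanExit x (Γ.ball x R)

/-- `F(R) = inf_x E(x,R)`. -/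
noncomputable def F {V : Type*} [Nontrivial V] [MeasurableSpace V]
    [DiscreteMeasurableSpace V] (Γ : WeightedGraph V) (R : ℝ) : ℝ≥0∞ :=
  ⨅ x, Γ.E x R

/-- Condition `(p₀)`. -/
def ControlledWeights {V : Type*} (Γ : WeightedGraph V) : Prop :=
  ∃ p₀ : ℝ, 0 < p₀ ∧ ∀ x y, Γ.Adj x y → p₀ ≤ Γ.P x y

/-- Volume doubling `(VD)`. -/
def VolumeDoubling {V : Type*} (Γ : WeightedGraph V) : Prop :=
  ∃ D : ℝ, 0 < D ∧ ∀ (x : V) (R : ℝ), 0 < R → Γ.vol x (2 * R) ≤ ENNReal.ofReal D * Γ.vol x R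

/-- Homogeneity of the mean exit time, `E(x,R) ≃ E(y,R)`, condition `(E)`. -/
def HomogeneousExit {V : Type*} [Nontrivial V] [MeasurableSpace V]
    [DiscreteMeasurableSpace V] (Γ : WeightedGraph V) : Prop :=
  ∃ C : ℝ, 1 < C ∧ ∀ (x y : V) (R : ℝ), 0 < R → Γ.E x R ≤ ENNReal.ofReal C * Γ.E y R

/-- A set together with all neighbours of its points. -/
def closure {V : Type*} (Γ : WeightedGraph V) (A : Set V) : Set V :=
  A ∪ {y | ∃ x ∈ A, Γ.Adj x y}

/-- `u` is harmonic on `A`: `∑_y P(x,y) u(y) = u(x)` for `x ∈ A`. Only the values of `u` on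
`Γ.closure A` matter. -/
def HarmonicOn {V : Type*} (Γ : WeightedGraph V) (u : V → ℝ) (A : Set V) : Prop :=
  ∀ x ∈ A, HasSum (fun y => Γ.P x y * u y) (u x)

/-- The elliptic Harnack inequality `(H)`. -/
def Harnack {V : Type*} (Γ : WeightedGraph V) : Prop :=
  ∃ H : ℝ, 1 < H ∧ ∀ (x : V) (R : ℝ), 0 < R → ∀ u : V → ℝ,
    (∀ y ∈ Γ.closure (Γ.ball x (2 * R)), 0 ≤ u y) → Γ.HarmonicOn u (Γ.ball x (2 * R)) →
      ∀ y ∈ Γ.ball x R, ∀ z ∈ Γ.ball x R, u y ≤ H * u z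

end WeightedGraph

namespace WeightedGraph

section Walk

variable {V : Type*} [Nontrivial V] [MeasurableSpace V] [DiscreteMeasurableSpace V]

/-- The transition operator on functions with values in `ℝ≥0∞`. -/
noncomputable def transition {V : Type*} (Γ : WeightedGraph V) (φ : V → ℝ≥0∞) (x : V) : ℝ≥0∞ :=
  ∑' y, ENNReal.ofReal (Γ.P x y) * φ y

theorem lintegral_stepPMF (Γ : WeightedGraph V) [Countable V] (x : V) (φ : V → ℝ≥0∞) :
    ∫⁻ y, φ y ∂(Γ.stepPMF x).toMeasure = Γ.transition φ x := by
  rw [lintegral_countable']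
  refine tsum_congr fun y => ?_
  rw [PMF.toMeasure_apply_singleton _ _ (measurableSet_singleton y), mul_comm]
  rfl

theorem map_eval_zero_walkLaw (Γ : WeightedGraph V) (z : V) :
    (Γ.walkLaw z).map (fun ω => ω 0) = Measure.dirac z := by
  have h1 : (fun ω : ℕ → V => ω 0) =
      (MeasurableEquiv.piUnique (fun _ : Finset.Iic 0 => V)) ∘ Preorder.frestrictLe 0 := rfl
  rw [h1, ← Measure.map_map (by fun_prop) (by fun_prop), walkLaw, Kernel.trajMeasure,
    Measure.map_comp _ _ (by fun_prop), Kernel.traj_map_frestrictLe, Kernel.partialTraj_self,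
    Measure.id_comp, Measure.map_map (by fun_prop) (by fun_prop)]
  simp

theorem lintegral_walkLaw_zero (Γ : WeightedGraph V) (z : V) (φ : V → ℝ≥0∞) :
    ∫⁻ ω, φ (ω 0) ∂Γ.walkLaw z = φ z := by
  rw [← lintegral_dirac z φ, ← map_eval_zero_walkLaw,
    lintegral_map (Measurable.of_discrete) (by fun_prop)]

theorem lintegral_walkLaw_succ [Countable V] (Γ : WeightedGraph V) (z : V) (n : ℕ)
    {f : (∀ _ : Finset.Iic n, V) → ℝ≥0∞} (hf : Measurable f) (φ : V → ℝ≥0∞) :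
    ∫⁻ ω, f (Preorder.frestrictLe n ω) * φ (ω (n + 1)) ∂Γ.walkLaw z =
      ∫⁻ ω, f (Preorder.frestrictLe n ω) * Γ.transition φ (ω n) ∂Γ.walkLaw z := by
  have hφ : Measurable φ := Measurable.of_discrete
  have hT : Measurable (Γ.transition φ) := Measurable.of_discrete
  have key := Kernel.map_frestrictLe_trajMeasure_compProd_eq_map_trajMeasure
    (X := fun _ => V) (μ₀ := Measure.dirac z) (κ := Γ.stepKernel) (a := n)
  have h1 : ∫⁻ ω, f (Preorder.frestrictLe n ω) * φ (ω (n + 1)) ∂Γ.walkLaw z =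
      ∫⁻ q : (∀ _ : Finset.Iic n, V) × V, f q.1 * φ q.2 ∂((Γ.walkLaw z).map
        (fun ω => (Preorder.frestrictLe n ω, ω (n + 1)))) := by
    rw [lintegral_map (by fun_prop) (by fun_prop)]
  have h2 : ∀ h : ∀ _ : Finset.Iic n, V, ∫⁻ y, f h * φ y ∂Γ.stepKernel n h =
      f h * Γ.transition φ (h ⟨n, Finset.mem_Iic.2 le_rfl⟩) := fun h => by
    rw [lintegral_const_mul _ hφ]
    exact congrArg _ (Γ.lintegral_stepPMF _ φ)
  rw [h1, walkLaw, ← key, Measure.lintegral_compProd (by fun_prop)]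
  simp only [h2]
  rw [lintegral_map (by fun_prop) (by fun_prop)]
  rfl

open Classical in
/-- `E_z(φ(X_n); X_0, …, X_n ∈ A)`. -/
noncomputable def killed (Γ : WeightedGraph V) (A : Set V) (n : ℕ) (φ : V → ℝ≥0∞) (z : V) :
    ℝ≥0∞ :=
  ∫⁻ ω, (if ∀ k ≤ n, ω k ∈ A then φ (ω n) else 0) ∂Γ.walkLaw z

theorem killed_zero (Γ : WeightedGraph V) (A : Set V) (φ : V → ℝ≥0∞) (z : V) :
    Γ.killed A 0 φ z = A.indicator φ z := by
  rw [killed, ← Γ.lintegral_walkLaw_zero z (A.indicator φ)]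
  refine lintegral_congr fun ω => ?_
  by_cases h : ω 0 ∈ A
  · rw [Set.indicator_of_mem h, if_pos fun k hk => by rwa [Nat.le_zero.1 hk]]
  · rw [Set.indicator_of_notMem h, if_neg fun h0 => h (h0 0 le_rfl)]

theorem killed_succ [Countable V] (Γ : WeightedGraph V) (A : Set V) (n : ℕ) (φ : V → ℝ≥0∞)
    (z : V) :
    Γ.killed A (n + 1) φ z = Γ.killed A n (Γ.transition (A.indicator φ)) z := by
  classical
  have hS : MeasurableSet {h : ∀ _ : Finset.Iic n, V | ∀ i, h i ∈ A} := by
    rw [Set.ofPred_forall]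
    exact MeasurableSet.iInter fun i => (measurable_pi_apply i) (MeasurableSet.of_discrete (s := A))
  have hf : Measurable (Set.indicator {h : ∀ _ : Finset.Iic n, V | ∀ i, h i ∈ A}
      (fun _ => (1 : ℝ≥0∞))) := measurable_const.indicator hS
  have h := Γ.lintegral_walkLaw_succ z n hf (A.indicator φ)
  have hiff : ∀ ω : ℕ → V, (∀ k ≤ n, ω k ∈ A) ↔
      Preorder.frestrictLe n ω ∈ {h : ∀ _ : Finset.Iic n, V | ∀ i, h i ∈ A} := fun ω =>
    ⟨fun h i => h i (Finset.mem_Iic.1 i.2), fun h k hk => h ⟨k, Finset.mem_Iic.2 hk⟩⟩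
  have e : ∀ (ω : ℕ → V) (t : ℝ≥0∞), (if ∀ k ≤ n, ω k ∈ A then t else 0) =
      Set.indicator {h : ∀ _ : Finset.Iic n, V | ∀ i, h i ∈ A} (fun _ => 1)
        (Preorder.frestrictLe n ω) * t := fun ω t => by
    rw [Set.indicator_apply, if_congr (hiff ω) rfl rfl, ite_mul, one_mul, zero_mul]
  simp only [← e] at h
  rw [killed, killed, ← h]
  refine lintegral_congr fun ω => ?_
  simp only [Set.indicator_apply, Nat.le_succ_iff, or_imp, forall_and, forall_eq,
    ← ite_and, Nat.succ_eq_add_one]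

theorem killed_succ' [Countable V] (Γ : WeightedGraph V) (A : Set V) (n : ℕ) (φ : V → ℝ≥0∞)
    (z : V) :
    Γ.killed A (n + 1) φ z = A.indicator (Γ.transition (Γ.killed A n φ)) z := by
  induction n generalizing φ z with
  | zero =>
    rw [killed_succ, killed_zero]
    congr 2
    ext y
    rw [killed_zero]
  | succ n ih =>
    rw [killed_succ, ih]
    congr 2
    ext y
    rw [killed_succ]

theorem exitTime_eq_tsum {V : Type*} (A : Set V) (ω : ℕ → V)
    [DecidablePred fun n => ∀ k ≤ n, ω k ∈ A] :
    (exitTime A ω : ℝ≥0∞) = ∑' n : ℕ, if ∀ k ≤ n, ω k ∈ A then 1 else 0 := by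
  classical
  by_cases h : ∃ k, ω k ∉ A
  · have e : exitTime A ω = (Nat.find h : ℕ∞) := by
      refine le_antisymm (iInf₂_le (Nat.find h) (Nat.find_spec h)) (le_iInf₂ fun k hk => ?_)
      exact_mod_cast Nat.find_min' h hk
    have hiff : ∀ n, (∀ k ≤ n, ω k ∈ A) ↔ n ∈ Finset.range (Nat.find h) := fun n => by
      simp [Nat.lt_find_iff]
    simp only [hiff]
    rw [tsum_eq_sum (s := Finset.range (Nat.find h)) (fun n hn => if_neg hn), e,
      Finset.sum_ite_mem]
    simp
  · push Not at h
    have e : exitTime A ω = ⊤ := by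
      simp [exitTime, h]
    simp [e, h]

theorem meanExit_eq_tsum [Countable V] (Γ : WeightedGraph V) (z : V) (A : Set V) :
    Γ.meanExit z A = ∑' n, Γ.killed A n 1 z := by
  classical
  simp only [meanExit, exitTime_eq_tsum, killed]
  rw [lintegral_tsum]
  · rfl
  · intro n
    refine (Measurable.ite ?_ measurable_const measurable_const).aemeasurable
    simp only [Set.ofPred_forall]
    exact MeasurableSet.iInter fun k => MeasurableSet.iInter fun _ =>
      (measurable_pi_apply k) (MeasurableSet.of_discrete (s := A))

theorem meanExit_eq [Countable V] (Γ : WeightedGraph V) (z : V) (A : Set V) :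
    Γ.meanExit z A = A.indicator (fun z => 1 + Γ.transition (fun y => Γ.meanExit y A) z) z := by
  rw [meanExit_eq_tsum, tsum_eq_zero_add' ENNReal.summable]
  simp only [killed_zero, killed_succ']
  by_cases hz : z ∈ A
  · simp only [Set.indicator_of_mem hz, transition, meanExit_eq_tsum, Pi.one_apply]
    rw [ENNReal.tsum_comm]
    simp only [ENNReal.tsum_mul_left]
  · simp [Set.indicator_of_notMem hz]

theorem meanExit_of_notMem [Countable V] (Γ : WeightedGraph V) {z : V} {A : Set V} (hz : z ∉ A) :
    Γ.meanExit z A = 0 := by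
  rw [meanExit_eq, Set.indicator_of_notMem hz]

theorem meanExit_of_mem [Countable V] (Γ : WeightedGraph V) {z : V} {A : Set V} (hz : z ∈ A) :
    Γ.meanExit z A = 1 + Γ.transition (fun y => Γ.meanExit y A) z := by
  rw [meanExit_eq, Set.indicator_of_mem hz]

/-- The mean exit time is the least non-negative solution of its one-step equation. -/
theorem meanExit_le [Countable V] (Γ : WeightedGraph V) (A : Set V) (w : V → ℝ≥0∞)
    (hw : ∀ z ∈ A, 1 + Γ.transition w z ≤ w z) (z : V) : Γ.meanExit z A ≤ w z := by
  have key : ∀ n z, ∑ k ∈ Finset.range n, Γ.killed A k 1 z ≤ w z := by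
    intro n
    induction n with
    | zero => simp
    | succ n ih =>
      intro z
      rw [Finset.sum_range_succ']
      simp only [killed_zero, killed_succ']
      by_cases hz : z ∈ A
      · simp only [Set.indicator_of_mem hz, Pi.one_apply]
        rw [add_comm]
        refine le_trans (add_le_add le_rfl ?_) (hw z hz)
        simp only [transition]
        rw [← Summable.tsum_finsetSum fun _ _ => ENNReal.summable]
        refine ENNReal.tsum_le_tsum fun y => ?_
        rw [← Finset.mul_sum]
        gcongr
        exact ih y
      · simp [Set.indicator_of_notMem hz]
  rw [meanExit_eq_tsum, ENNReal.tsum_eq_iSup_nat]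
  exact iSup_le fun n => key n z

theorem meanExit_mono (Γ : WeightedGraph V) (z : V) {A B : Set V} (h : A ⊆ B) :
    Γ.meanExit z A ≤ Γ.meanExit z B := by
  refine lintegral_mono fun ω => ?_
  have : exitTime A ω ≤ exitTime B ω :=
    le_iInf₂ fun k hk => iInf₂_le k fun hA => hk (h hA)
  exact ENat.toENNReal_mono this

end Walk

section Potential

variable {V : Type*} (Γ : WeightedGraph V)

theorem Adj.symm' {Γ : WeightedGraph V} {x y : V} (h : Γ.Adj x y) : Γ.Adj y x := by
  unfold Adj at *
  rwa [Γ.symm]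

theorem adj_of_graph_adj {x y : V} (h : Γ.graph.Adj x y) : Γ.Adj x y := by
  rcases ((SimpleGraph.fromRel_adj _ _ _).1 h).2 with h | h
  · exact h
  · exact Adj.symm' h

theorem graph_connected : Γ.graph.Connected := Γ.connected

theorem dist_le_one_of_adj {x y : V} (h : Γ.Adj x y) : Γ.graph.dist x y ≤ 1 := by
  by_cases e : x = y
  · simp [e]
  · have : Γ.graph.Adj x y := (SimpleGraph.fromRel_adj _ _ _).2 ⟨e, Or.inl h⟩
    exact (SimpleGraph.dist_eq_one_iff_adj.2 this).le

theorem exists_dist_eq {a b : V} {k : ℕ} (h : k ≤ Γ.graph.dist a b) :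
    ∃ c, Γ.graph.dist a c = k ∧ Γ.graph.dist c b = Γ.graph.dist a b - k := by
  obtain ⟨w, hw⟩ := Γ.graph_connected.exists_walk_length_eq_dist a b
  refine ⟨w.getVert k, ?_⟩
  have h1 := SimpleGraph.dist_le (w.take k)
  have h2 := SimpleGraph.dist_le (w.drop k)
  have h3 := Γ.graph_connected.dist_triangle (u := a) (v := w.getVert k) (w := b)
  rw [SimpleGraph.Walk.take_length] at h1
  rw [SimpleGraph.Walk.drop_length] at h2
  omega

theorem P_pos [Nontrivial V] {x y : V} (h : Γ.Adj x y) : 0 < Γ.P x y :=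
  div_pos h (Γ.mass_pos x)

theorem P_eq_zero {x y : V} (h : ¬ Γ.Adj x y) : Γ.P x y = 0 := by
  have : Γ.weight x y = 0 := le_antisymm (not_lt.1 h) (Γ.nonneg x y)
  simp [P, this]

theorem finite_setOf_adj [Nontrivial V] (hp : Γ.ControlledWeights) (x : V) :
    {y | Γ.Adj x y}.Finite := by
  obtain ⟨p₀, h0, h⟩ := hp
  have := (Γ.hasSum_P x).summable.tendsto_cofinite_zero.eventually (gt_mem_nhds h0)
  rw [Filter.eventually_cofinite] at this
  exact this.subset fun y hy => not_lt.2 (h x y hy)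

theorem finite_ball [Nontrivial V] (hp : Γ.ControlledWeights) (x : V) (R : ℝ) :
    (Γ.ball x R).Finite := by
  have key : ∀ n : ℕ, {y | Γ.graph.dist x y ≤ n}.Finite := by
    intro n
    induction n with
    | zero =>
      refine (Set.finite_singleton x).subset fun y hy => ?_
      exact (Γ.graph_connected.dist_eq_zero_iff.1 (Nat.le_zero.1 hy)).symm
    | succ n ih =>
      refine (ih.union (ih.biUnion fun c _ => Γ.finite_setOf_adj hp c)).subset fun y hy => ?_
      rcases Nat.lt_or_ge n (Γ.graph.dist x y) with h | h
      · obtain ⟨c, h1, h2⟩ := Γ.exists_dist_eq h.le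
        have hy' : Γ.graph.dist x y ≤ n + 1 := hy
        have h3 : Γ.graph.dist c y = 1 := by omega
        exact Or.inr (Set.mem_biUnion (x := c) h1.le
          (Γ.adj_of_graph_adj (SimpleGraph.dist_eq_one_iff_adj.1 h3)))
      · exact Or.inl h
  refine (key ⌈R⌉₊).subset fun y (hy : (Γ.graph.dist x y : ℝ) < R) => ?_
  exact_mod_cast hy.le.trans (Nat.le_ceil R)

/-- The averaging operator `P` on real functions. -/
noncomputable def avg (f : V → ℝ) (x : V) : ℝ := ∑' y, Γ.P x y * f y

variable {Γ}

theorem hasSum_avg (hΓ : ∀ x, {y | Γ.Adj x y}.Finite) (f : V → ℝ) (x : V) :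
    HasSum (fun y => Γ.P x y * f y) (Γ.avg f x) := by
  refine (summable_of_hasFiniteSupport ((hΓ x).subset fun y hy => ?_)).hasSum
  by_contra h
  exact hy (by simp [Γ.P_eq_zero h])

theorem avg_const_mul_add [Nontrivial V] (hΓ : ∀ x, {y | Γ.Adj x y}.Finite) (f g : V → ℝ)
    (s t c : ℝ) (x : V) :
    Γ.avg (fun y => s * f y + t * g y + c) x = s * Γ.avg f x + t * Γ.avg g x + c := by
  have h := ((((hasSum_avg hΓ f x).mul_left s).add ((hasSum_avg hΓ g x).mul_left t)).add
    ((Γ.hasSum_P x).mul_left c))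
  rw [mul_one] at h
  rw [← h.tsum_eq]
  exact tsum_congr fun y => by ring

theorem mul_le_avg (hΓ : ∀ x, {y | Γ.Adj x y}.Finite) {f : V → ℝ} {x : V}
    (hf : ∀ y, Γ.Adj x y → 0 ≤ f y) (y : V) : Γ.P x y * f y ≤ Γ.avg f x := by
  refine le_hasSum (hasSum_avg hΓ f x) y fun z _ => ?_
  by_cases h : Γ.Adj x z
  · exact mul_nonneg (Γ.P_nonneg x z) (hf z h)
  · simp [Γ.P_eq_zero h]

/-- The minimum principle on a finite set. -/
theorem nonneg_of_avg_le [Infinite V] (hΓ : ∀ x, {y | Γ.Adj x y}.Finite) {A : Set V}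
    (hA : A.Finite) {f : V → ℝ} (hf : ∀ x ∈ A, Γ.avg f x ≤ f x)
    (hb : ∀ x ∈ A, ∀ y ∉ A, Γ.Adj x y → 0 ≤ f y) {x : V} (hx : x ∈ A) : 0 ≤ f x := by
  obtain ⟨x₀, h0, hmin⟩ := Set.exists_min_image A f hA ⟨x, hx⟩
  refine le_trans ?_ (hmin x hx)
  by_contra! hneg
  have step : ∀ a ∈ A, f a = f x₀ → ∀ b, Γ.Adj a b → b ∈ A ∧ f b = f x₀ := by
    intro a ha hfa b hab
    have hge : ∀ c, Γ.Adj a c → f x₀ ≤ f c := fun c hc => by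
      by_cases hcA : c ∈ A
      · exact hmin c hcA
      · exact hneg.le.trans (hb a ha c hcA hc)
    have h1 := mul_le_avg hΓ (f := fun y => 1 * f y + 0 * f y + (-f x₀)) (x := a)
      (fun c hc => by have := hge c hc; linarith) b
    rw [avg_const_mul_add hΓ] at h1
    have h2 := hf a ha
    have h3 : Γ.P a b * (f b - f x₀) ≤ 0 := by
      have e : Γ.P a b * (1 * f b + 0 * f b + -f x₀) = Γ.P a b * (f b - f x₀) := by ring
      linarith
    have h4 : f b - f x₀ ≤ 0 := by
      by_contra! h5
      exact absurd (mul_pos (Γ.P_pos hab) h5) (not_lt.2 h3)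
    have h6 : f b = f x₀ := le_antisymm (by linarith) (hge b hab)
    refine ⟨?_, h6⟩
    by_contra hbA
    have := hb a ha b hbA hab
    linarith
  have all : ∀ a b, Γ.graph.Walk a b → a ∈ A → f a = f x₀ → b ∈ A := by
    intro a b w
    induction w with
    | nil => exact fun h _ => h
    | cons h _ ih =>
      intro ha hfa
      have := step _ ha hfa _ (Γ.adj_of_graph_adj h)
      exact ih this.1 this.2
  refine Set.infinite_univ (α := V) (hA.subset fun b _ => ?_)
  obtain ⟨w⟩ := Γ.graph_connected.preconnected x₀ b
  exact all _ _ w h0 rfl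

theorem avg_extend [Nontrivial V] {U : Set V} [Fintype U] {f : V → ℝ} (hf : ∀ x ∉ U, f x = 0)
    (x : V) : Γ.mass x * Γ.avg f x = ∑ b : U, Γ.weight x b * f b := by
  have h : ∑' b : U, Γ.P x b * f b = Γ.avg f x := by
    refine tsum_subtype_eq_of_support_subset (f := fun y => Γ.P x y * f y) fun y hy => ?_
    by_contra h
    exact hy (by simp [hf y h])
  rw [← h, tsum_fintype, Finset.mul_sum]
  refine Finset.sum_congr rfl fun b _ => ?_
  rw [P]
  field_simp [(Γ.mass_pos x).ne']

open Classical in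
/-- The Green function of a finite set. -/
theorem exists_green [Infinite V] (hΓ : ∀ x, {y | Γ.Adj x y}.Finite) {U : Set V}
    (hU : U.Finite) :
    ∃ g : V → V → ℝ, (∀ a b, g a b = g b a) ∧ (∀ a b, 0 ≤ g a b) ∧ (∀ a ∉ U, ∀ b, g a b = 0) ∧
      ∀ a ∈ U, ∀ b ∈ U,
        g a b - Γ.avg (fun c => g c b) a = if a = b then (Γ.mass a)⁻¹ else 0 := by
  have := hU.fintype
  let L : Matrix U U ℝ := Matrix.of fun a b => (if a = b then Γ.mass a else 0) - Γ.weight a b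
  have hLs : L.transpose = L := by
    ext a b
    simp only [L, Matrix.transpose_apply, Matrix.of_apply, Γ.symm b a, eq_comm (a := b)]
    by_cases e : a = b <;> simp [e]
  have hL : ∀ f : V → ℝ, (∀ x ∉ U, f x = 0) → ∀ a : U,
      (L.mulVec fun b => f b) a = Γ.mass a * (f a - Γ.avg f a) := by
    intro f hf a
    rw [mul_sub, avg_extend hf]
    simp [L, Matrix.mulVec, dotProduct, sub_mul, Finset.sum_sub_distrib]
  let ext : (U → ℝ) → V → ℝ := fun f v => if h : v ∈ U then f ⟨v, h⟩ else 0
  have ext0 : ∀ f, ∀ x ∉ U, ext f x = 0 := fun f x hx => dif_neg hx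
  have ext1 : ∀ f, ∀ x : U, ext f x = f x := fun f x => dif_pos x.2
  have hdet : IsUnit L.det := by
    rw [isUnit_iff_ne_zero]
    intro h0
    obtain ⟨v, hv, hLv⟩ := Matrix.exists_mulVec_eq_zero_iff.2 h0
    have hv' : (fun b : U => ext v b) = v := funext (ext1 v)
    have harm : ∀ x ∈ U, Γ.avg (ext v) x = ext v x := by
      intro x hx
      have h := hL (ext v) (ext0 v) ⟨x, hx⟩
      rw [hv', hLv] at h
      have := (mul_eq_zero.1 h.symm).resolve_left (Γ.mass_pos x).ne'
      linarith
    refine hv (funext fun b => ?_)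
    have h1 : 0 ≤ ext v b := nonneg_of_avg_le hΓ hU (fun x hx => (harm x hx).le)
      (fun _ _ y hy _ => (ext0 v y hy).ge) b.2
    have h2 : 0 ≤ -1 * ext v b + 0 * ext v b + 0 :=
      nonneg_of_avg_le (f := fun y => -1 * ext v y + 0 * ext v y + 0) hΓ hU
        (fun x hx => by rw [avg_const_mul_add hΓ, harm x hx])
        (fun _ _ y hy _ => by simp [ext0 v y hy]) b.2
    rw [ext1] at h1 h2
    simp only [Pi.zero_apply]
    linarith
  let g : V → V → ℝ := fun a b => if h : b ∈ U then ext (fun c => L⁻¹ c ⟨b, h⟩) a else 0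
  have gU : ∀ a b : U, g a b = L⁻¹ a b := fun a b => by
    simp only [g, dif_pos b.2, ext1]
  have g0 : ∀ a ∉ U, ∀ b, g a b = 0 := fun a ha b => by
    simp only [g]
    split_ifs with h
    · exact ext0 (fun c => L⁻¹ c ⟨b, h⟩) a ha
    · rfl
  have g0' : ∀ b ∉ U, ∀ a, g a b = 0 := fun b hb a => dif_neg hb
  have eqn : ∀ a ∈ U, ∀ b ∈ U,
      g a b - Γ.avg (fun c => g c b) a = if a = b then (Γ.mass a)⁻¹ else 0 := by
    intro a ha b hb
    have h := hL (fun c => g c b) (fun x hx => g0 x hx b) ⟨a, ha⟩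
    have h1 : (fun c : U => g c b) = fun c => L⁻¹ c ⟨b, hb⟩ := funext fun c => gU c ⟨b, hb⟩
    have h2 := congrFun (congrFun (Matrix.mul_nonsing_inv L hdet) ⟨a, ha⟩) ⟨b, hb⟩
    have h3 : (L.mulVec fun c : U => g c b) ⟨a, ha⟩ = (L * L⁻¹) ⟨a, ha⟩ ⟨b, hb⟩ := by
      rw [h1]; rfl
    rw [h3, h2, Matrix.one_apply] at h
    have hm := (Γ.mass_pos a).ne'
    simp only [Subtype.mk.injEq] at h
    split_ifs at h ⊢ with e
    · exact eq_inv_of_mul_eq_one_right h.symm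
    · exact (mul_eq_zero.1 h.symm).resolve_left hm
  refine ⟨g, fun a b => ?_, fun a b => ?_, g0, eqn⟩
  · by_cases ha : a ∈ U
    · by_cases hb : b ∈ U
      · have h : L⁻¹.transpose = L⁻¹ := by rw [Matrix.transpose_nonsing_inv, hLs]
        have h' := congrFun (congrFun h ⟨b, hb⟩) ⟨a, ha⟩
        rw [Matrix.transpose_apply, ← gU, ← gU] at h'
        exact h'
      · rw [g0' b hb, g0 b hb]
    · rw [g0' a ha, g0 a ha]
  · by_cases hb : b ∈ U
    · by_cases ha : a ∈ U
      · refine nonneg_of_avg_le (f := fun c => g c b) hΓ hU (fun x hx => ?_)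
          (fun _ _ y hy _ => (g0 y hy b).ge) ha
        have := eqn x hx b hb
        have h2 : (0 : ℝ) ≤ if x = b then (Γ.mass x)⁻¹ else 0 := by
          split_ifs
          · exact (inv_pos.2 (Γ.mass_pos x)).le
          · exact le_rfl
        linarith
      · exact (g0 a ha b).ge
    · exact (g0' b hb a).ge

theorem avg_sum (hΓ : ∀ x, {y | Γ.Adj x y}.Finite) {ι : Type*} (s : Finset ι) (f : ι → V → ℝ)
    (x : V) : Γ.avg (fun y => ∑ i ∈ s, f i y) x = ∑ i ∈ s, Γ.avg (f i) x := by
  rw [← (hasSum_sum fun i _ => hasSum_avg hΓ (f i) x).tsum_eq]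
  exact tsum_congr fun y => Finset.mul_sum _ _ _

theorem transition_ofReal [Nontrivial V] (hΓ : ∀ x, {y | Γ.Adj x y}.Finite) {f : V → ℝ}
    (hf : ∀ x, 0 ≤ f x) (x : V) :
    Γ.transition (fun y => ENNReal.ofReal (f y)) x = ENNReal.ofReal (Γ.avg f x) := by
  rw [avg, ENNReal.ofReal_tsum_of_nonneg (fun y => mul_nonneg (Γ.P_nonneg x y) (hf y))
    (hasSum_avg hΓ f x).summable]
  exact tsum_congr fun y => (ENNReal.ofReal_mul (Γ.P_nonneg x y)).symm

variable [MeasurableSpace V] [DiscreteMeasurableSpace V] [Countable V]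

theorem meanExit_ne_top [Infinite V] (hΓ : ∀ x, {y | Γ.Adj x y}.Finite) {U : Set V}
    (hU : U.Finite) (z : V) : Γ.meanExit z U ≠ ⊤ := by
  classical
  obtain ⟨g, -, hg0, -, hg⟩ := exists_green hΓ hU
  let f : V → ℝ := fun a => ∑ b ∈ hU.toFinset, Γ.mass b * g a b
  have hf : ∀ a, 0 ≤ f a := fun a =>
    Finset.sum_nonneg fun b _ => mul_nonneg (Γ.mass_pos b).le (hg0 a b)
  refine ((Γ.meanExit_le U (fun a => ENNReal.ofReal (f a)) (fun a ha => ?_) z).trans_lt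
    ENNReal.ofReal_lt_top).ne
  have h : f a = 1 + Γ.avg f a := by
    rw [show Γ.avg f a = ∑ b ∈ hU.toFinset, Γ.mass b * Γ.avg (fun c => g c b) a by
      rw [avg_sum hΓ]
      refine Finset.sum_congr rfl fun b _ => ?_
      have := avg_const_mul_add hΓ (fun c => g c b) 0 (Γ.mass b) 0 0 a
      simpa using this]
    rw [← sub_eq_iff_eq_add, ← Finset.sum_sub_distrib]
    simp only [← mul_sub]
    rw [Finset.sum_eq_single_of_mem a (hU.mem_toFinset.2 ha), hg a ha a ha, if_pos rfl,
      mul_inv_cancel₀ (Γ.mass_pos a).ne']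
    intro b hb hba
    rw [hg a ha b (hU.mem_toFinset.1 hb), if_neg hba.symm, mul_zero]
  have h0 : 0 ≤ Γ.avg f a := tsum_nonneg fun y => mul_nonneg (Γ.P_nonneg a y) (hf y)
  rw [transition_ofReal hΓ hf, h, ENNReal.ofReal_add zero_le_one h0, ENNReal.ofReal_one]

theorem toReal_meanExit_of_mem [Infinite V] (hΓ : ∀ x, {y | Γ.Adj x y}.Finite) {U : Set V}
    (hU : U.Finite) {z : V} (hz : z ∈ U) :
    (Γ.meanExit z U).toReal = 1 + Γ.avg (fun y => (Γ.meanExit y U).toReal) z := by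
  have h := Γ.meanExit_of_mem hz
  have e : (fun y => Γ.meanExit y U) = fun y => ENNReal.ofReal (Γ.meanExit y U).toReal :=
    funext fun y => (ENNReal.ofReal_toReal (meanExit_ne_top hΓ hU y)).symm
  rw [e, transition_ofReal hΓ fun _ => ENNReal.toReal_nonneg] at h
  rw [h, ENNReal.toReal_add ENNReal.one_ne_top ENNReal.ofReal_ne_top, ENNReal.toReal_one,
    ENNReal.toReal_ofReal]
  exact tsum_nonneg fun y => mul_nonneg (Γ.P_nonneg z y) ENNReal.toReal_nonneg

theorem toReal_meanExit_of_notMem [Nontrivial V] {U : Set V} {z : V} (hz : z ∉ U) :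
    (Γ.meanExit z U).toReal = 0 := by
  rw [Γ.meanExit_of_notMem hz, ENNReal.toReal_zero]

end Potential

section HarnackChain

variable {V : Type*} {Γ : WeightedGraph V}

theorem mem_ball {x y : V} {R : ℝ} : y ∈ Γ.ball x R ↔ (Γ.graph.dist x y : ℝ) < R := Iff.rfl

theorem mul_le_of_adj (hΓ : ∀ x, {y | Γ.Adj x y}.Finite) {p₀ : ℝ}
    (hp : ∀ x y, Γ.Adj x y → p₀ ≤ Γ.P x y) {f : V → ℝ} (hf : ∀ x, 0 ≤ f x) {a b : V}
    (hab : Γ.Adj a b) (hb : Γ.avg f b ≤ f b) : p₀ * f a ≤ f b :=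
  ((mul_le_mul_of_nonneg_right (hp b a hab.symm') (hf a)).trans
    (mul_le_avg hΓ (fun y _ => hf y) a)).trans hb

/-- Chaining of the one-step inequality and of the Harnack inequality at scale `ρ` along a
geodesic on which `f` is harmonic. -/
theorem harnack_chain (hΓ : ∀ x, {y | Γ.Adj x y}.Finite) {p₀ H K ρ : ℝ} (hp0 : 0 < p₀)
    (hp : ∀ x y, Γ.Adj x y → p₀ ≤ Γ.P x y) (hρ : 0 < ρ)
    (hH : ∀ (x : V) (R : ℝ), 0 < R → ∀ u : V → ℝ,
      (∀ y ∈ Γ.closure (Γ.ball x (2 * R)), 0 ≤ u y) → Γ.HarmonicOn u (Γ.ball x (2 * R)) →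
        ∀ y ∈ Γ.ball x R, ∀ z ∈ Γ.ball x R, u y ≤ H * u z)
    (hK1 : 1 ≤ K) (hKp : p₀⁻¹ ≤ K) (hKH : H ≤ K) {s : ℕ} (hs : s = 1 ∨ (s : ℝ) < ρ)
    {f : V → ℝ} (hf : ∀ x, 0 ≤ f x) (N : ℕ) (a b : V) (hd : Γ.graph.dist a b ≤ N * s)
    (hharm : ∀ p, Γ.graph.dist a p + Γ.graph.dist p b = Γ.graph.dist a b →
      Γ.HarmonicOn f (Γ.ball p (2 * ρ))) :
    f a ≤ K ^ N * f b := by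
  have step : ∀ a b, Γ.graph.dist a b ≤ s → Γ.HarmonicOn f (Γ.ball a (2 * ρ)) →
      Γ.HarmonicOn f (Γ.ball b (2 * ρ)) → f a ≤ K * f b := by
    intro a b hab ha hb
    rcases hs with rfl | hs
    · rcases Nat.le_one_iff_eq_zero_or_eq_one.1 hab with h | h
      · rw [Γ.graph_connected.dist_eq_zero_iff.1 h]
        exact le_mul_of_one_le_left (hf b) hK1
      · have hbb := hb b (by simp [mem_ball, hρ])
        have h1 := mul_le_of_adj hΓ hp hf
          (Γ.adj_of_graph_adj (SimpleGraph.dist_eq_one_iff_adj.1 h)) hbb.tsum_eq.le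
        calc f a = p₀⁻¹ * (p₀ * f a) := by field_simp
          _ ≤ p₀⁻¹ * f b := by gcongr
          _ ≤ K * f b := mul_le_mul_of_nonneg_right hKp (hf b)
    · refine (hH a ρ hρ f (fun y _ => hf y) ha a (by simp [mem_ball, hρ]) b ?_).trans
        (mul_le_mul_of_nonneg_right hKH (hf b))
      exact lt_of_le_of_lt (by exact_mod_cast hab) hs
  induction N generalizing a with
  | zero =>
    have h : Γ.graph.dist a b = 0 := by omega
    rw [Γ.graph_connected.dist_eq_zero_iff.1 h, pow_zero, one_mul]
  | succ N ih =>
    have hK0 : 0 ≤ K := zero_le_one.trans hK1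
    rcases le_total (Γ.graph.dist a b) s with h | h
    · refine (step a b h (hharm a (by simp)) (hharm b (by simp))).trans ?_
      exact mul_le_mul_of_nonneg_right (le_self_pow₀ hK1 (Nat.succ_ne_zero N)) (hf b)
    · obtain ⟨c, h1, h2⟩ := Γ.exists_dist_eq h
      have h3 := step a c h1.le (hharm a (by simp)) (hharm c (by omega))
      have h4 := ih c (by rw [h2, Nat.sub_le_iff_le_add]; linarith) (fun p hp => hharm p (by
        have t1 := Γ.graph_connected.dist_triangle (u := a) (v := c) (w := p)
        have t2 := Γ.graph_connected.dist_triangle (u := a) (v := p) (w := b)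
        omega))
      calc f a ≤ K * f c := h3
        _ ≤ K * (K ^ N * f b) := by gcongr
        _ = K ^ (N + 1) * f b := by ring

theorem exists_step_size (R : ℕ) :
    ∃ s : ℕ, (s = 1 ∨ (s : ℝ) < (R : ℝ) / 16) ∧ 2 * R ≤ 64 * s := by
  rcases Nat.lt_or_ge 32 R with h | h
  · refine ⟨⌈(R : ℝ) / 16⌉₊ - 1, Or.inr ?_, ?_⟩
    · have h1 := Nat.ceil_lt_add_one (a := (R : ℝ) / 16) (by positivity)
      have h2 : 1 ≤ ⌈(R : ℝ) / 16⌉₊ := Nat.one_le_ceil_iff.2 (by positivity)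
      push_cast [h2]
      linarith
    · have h1 := Nat.le_ceil ((R : ℝ) / 16)
      have h2 : (R : ℝ) ≤ (16 * ⌈(R : ℝ) / 16⌉₊ : ℕ) := by push_cast; linarith
      have h3 : R ≤ 16 * ⌈(R : ℝ) / 16⌉₊ := by exact_mod_cast h2
      omega
  · exact ⟨1, Or.inl rfl, by omega⟩

/-- The Harnack inequality for Green functions, between the spheres of radii `R - 1` and `2R`. -/
theorem green_comparison [Infinite V] (hp : Γ.ControlledWeights) (hH : Γ.Harnack) :
    ∃ C : ℝ, 1 ≤ C ∧ ∀ (x : V) (R : ℕ) (g : V → V → ℝ), 1 ≤ R → (∀ a b, g a b = g b a) →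
      (∀ a b, 0 ≤ g a b) →
      (∀ a ∈ Γ.ball x (3 * R), ∀ b ∈ Γ.ball x (3 * R), a ≠ b →
        Γ.avg (fun c => g c b) a = g a b) →
      ∀ y z, Γ.graph.dist x y + 1 = R → Γ.graph.dist x z = 2 * R → g y x ≤ C * g z x := by
  have hΓ := Γ.finite_setOf_adj hp
  obtain ⟨p₀, hp0, hp⟩ := hp
  obtain ⟨H, -, hH⟩ := hH
  let K := max 1 (max p₀⁻¹ H)
  have hK1 : 1 ≤ K := le_max_left _ _
  have hKp : p₀⁻¹ ≤ K := (le_max_left _ _).trans (le_max_right _ _)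
  have hKH : H ≤ K := (le_max_right _ _).trans (le_max_right _ _)
  have hK0 : 0 ≤ K := zero_le_one.trans hK1
  refine ⟨K ^ 64 * K ^ 64, one_le_mul_of_one_le_of_one_le (one_le_pow₀ hK1) (one_le_pow₀ hK1),
    fun x R g hR hsymm hg0 hg y z hy hz => ?_⟩
  have tri := fun u v w => Γ.graph_connected.dist_triangle (u := u) (v := v) (w := w)
  have comm := fun u v => Γ.graph.dist_comm (u := u) (v := v)
  have hR1 : (1 : ℝ) ≤ R := by exact_mod_cast hR
  obtain ⟨s, hs, hs2⟩ := exists_step_size R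
  have chain := fun (f : V → ℝ) (hf : ∀ x, 0 ≤ f x) (a b : V) (hd : Γ.graph.dist a b ≤ 64 * s) =>
    harnack_chain hΓ hp0 hp (ρ := (R : ℝ) / 16) (by positivity) hH hK1 hKp hKH hs hf 64 a b hd
  have harm : ∀ b p, b ∈ Γ.ball x (3 * R) → Γ.graph.dist x p ≤ 2 * R →
      (R : ℝ) / 8 ≤ Γ.graph.dist p b →
      Γ.HarmonicOn (fun c => g c b) (Γ.ball p (2 * ((R : ℝ) / 16))) := by
    intro b p hb hxp hpb a ha
    rw [mem_ball] at ha
    have h1 : (Γ.graph.dist x a : ℝ) ≤ Γ.graph.dist x p + Γ.graph.dist p a := by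
      exact_mod_cast tri x p a
    have h2 : (Γ.graph.dist x p : ℝ) ≤ 2 * R := by exact_mod_cast hxp
    have hab : a ≠ b := by
      rintro rfl
      linarith
    have h := hasSum_avg hΓ (fun c => g c b) a
    rwa [hg a (by rw [mem_ball]; linarith) b hb hab] at h
  have ballx : x ∈ Γ.ball x (3 * R) := by simp [mem_ball]; omega
  have ball_of : ∀ b, Γ.graph.dist x b ≤ 2 * R → b ∈ Γ.ball x (3 * R) := fun b hb => by
    have : (Γ.graph.dist x b : ℝ) ≤ 2 * R := by exact_mod_cast hb
    rw [mem_ball]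
    linarith
  by_cases hA : ∀ p, Γ.graph.dist x p + Γ.graph.dist p z = Γ.graph.dist x z →
      (R : ℝ) / 8 ≤ Γ.graph.dist p y
  · have h1 := chain (fun c => g c y) (fun c => hg0 c y) x z (by omega) fun p hp =>
      harm y p (ball_of y (by omega)) (by omega) (hA p hp)
    have h2 := chain (fun c => g c z) (fun c => hg0 c z) y x (by rw [comm]; omega) fun p hp =>
      harm z p (ball_of z hz.le) (by have := comm x p; have := comm x y; omega) (by
        have h3 : R ≤ Γ.graph.dist p z := by
          have := comm x p; have := comm x y; have := tri x p z; omega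
        have h4 : (R : ℝ) ≤ Γ.graph.dist p z := by exact_mod_cast h3
        linarith)
    calc g y x = g x y := hsymm _ _
      _ ≤ K ^ 64 * g z y := h1
      _ = K ^ 64 * g y z := by rw [hsymm z y]
      _ ≤ K ^ 64 * (K ^ 64 * g x z) := by gcongr
      _ = K ^ 64 * K ^ 64 * g z x := by rw [hsymm x z]; ring
  · push Not at hA
    obtain ⟨p, hp1, hp2⟩ := hA
    rcases Nat.lt_or_ge 1 R with hR2 | hR2
    · have hR2' : (2 : ℝ) ≤ R := by exact_mod_cast hR2
      have hyR : (Γ.graph.dist x y : ℝ) + 1 = R := by exact_mod_cast hy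
      have hyp : Γ.graph.dist y p ≤ R := by
        have : (Γ.graph.dist p y : ℝ) ≤ R := by linarith
        rw [comm]
        exact_mod_cast this
      have hxp : (Γ.graph.dist x y : ℝ) ≤ Γ.graph.dist x p + Γ.graph.dist p y := by
        exact_mod_cast tri x p y
      have h1 := chain (fun c => g c x) (fun c => hg0 c x) y p (by omega) fun q hq =>
        harm x q ballx (by have := tri x y q; omega) (by
          have t1 : (Γ.graph.dist x y : ℝ) ≤ Γ.graph.dist x q + Γ.graph.dist q y := by
            exact_mod_cast tri x q y
          have t2 : (Γ.graph.dist y q : ℝ) + Γ.graph.dist q p = Γ.graph.dist y p := by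
            exact_mod_cast hq
          rw [comm p y] at hp2
          rw [comm q y] at t1
          rw [comm q x]
          have t3 : (0 : ℝ) ≤ Γ.graph.dist q p := Nat.cast_nonneg _
          linarith)
      have h2 := chain (fun c => g c x) (fun c => hg0 c x) p z (by omega) fun q hq =>
        harm x q ballx (by have := tri x p q; omega) (by
          have t1 : Γ.graph.dist x p ≤ Γ.graph.dist x q := by have := tri x q z; omega
          have t2 : (Γ.graph.dist x p : ℝ) ≤ Γ.graph.dist x q := by exact_mod_cast t1
          rw [comm q x]
          linarith)
      calc g y x ≤ K ^ 64 * g p x := h1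
        _ ≤ K ^ 64 * (K ^ 64 * g z x) := by gcongr
        _ = K ^ 64 * K ^ 64 * g z x := by ring
    · obtain rfl : R = 1 := by omega
      obtain rfl : x = y := Γ.graph_connected.dist_eq_zero_iff.1 (by omega)
      obtain ⟨m, hm1, hm2⟩ := Γ.exists_dist_eq (a := x) (b := z) (k := 1) (by omega)
      have hone : ∀ a b, Γ.graph.dist a b = 1 → Γ.graph.dist x b ≤ 2 → b ≠ x →
          g a x ≤ K ^ 64 * g b x := by
        intro a b hab hb hbx
        have h1 := mul_le_of_adj hΓ hp (f := fun c => g c x) (fun c => hg0 c x)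
          (Γ.adj_of_graph_adj (SimpleGraph.dist_eq_one_iff_adj.1 hab))
          (hg b (ball_of b (by omega)) x ballx hbx).le
        calc g a x = p₀⁻¹ * (p₀ * g a x) := by field_simp
          _ ≤ p₀⁻¹ * g b x := by gcongr
          _ ≤ K ^ 64 * g b x :=
            mul_le_mul_of_nonneg_right (hKp.trans (le_self_pow₀ hK1 (by norm_num))) (hg0 b x)
      have h1 := hone x m hm1 (by omega) (by rintro rfl; simp at hm1)
      have h2 := hone m z (by omega) (by omega) (by rintro rfl; simp at hz)
      calc g x x ≤ K ^ 64 * g m x := h1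
        _ ≤ K ^ 64 * (K ^ 64 * g z x) := by gcongr
        _ = K ^ 64 * K ^ 64 * g z x := by ring

end HarnackChain

section AntiDoubling

variable {V : Type*} [Countable V] [Infinite V] [MeasurableSpace V] [DiscreteMeasurableSpace V]
  {Γ : WeightedGraph V}

/-- If the walk leaves `A ⊆ B` only at points with mean exit time from `B` at least `m`, then
`E_z(T_A) + m ≤ E_z(T_B)` for `z ∈ A`. -/
theorem toReal_meanExit_add_le (hΓ : ∀ x, {y | Γ.Adj x y}.Finite) {A B : Set V} (hB : B.Finite)
    (hAB : A ⊆ B) {m : ℝ}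
    (hm : ∀ x ∈ A, ∀ y ∉ A, Γ.Adj x y → m ≤ (Γ.meanExit y B).toReal) {z : V} (hz : z ∈ A) :
    (Γ.meanExit z A).toReal + m ≤ (Γ.meanExit z B).toReal := by
  have hA := hB.subset hAB
  have h := nonneg_of_avg_le hΓ hA (f := fun y => 1 * (Γ.meanExit y B).toReal +
    (-1) * (Γ.meanExit y A).toReal + (-m)) (fun x hx => by
      rw [avg_const_mul_add hΓ, toReal_meanExit_of_mem hΓ hA hx,
        toReal_meanExit_of_mem hΓ hB (hAB hx)]
      linarith) (fun x hx y hy hxy => by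
      rw [toReal_meanExit_of_notMem hy]
      linarith [hm x hx y hy hxy]) hz
  linarith

theorem dist_eq_of_adj_ball {V : Type*} {Γ : WeightedGraph V} {x y z : V} {R : ℕ}
    (hy : y ∈ Γ.ball x R) (hz : z ∉ Γ.ball x R)
    (h : Γ.Adj y z) : Γ.graph.dist x z = R := by
  have h1 := dist_le_one_of_adj Γ h
  have h2 := Γ.graph_connected.dist_triangle (u := x) (v := y) (w := z)
  rw [mem_ball, Nat.cast_lt] at hy hz
  omega

theorem ball_subset_ball {V : Type*} {Γ : WeightedGraph V} {x y : V} {R S : ℝ}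
    (h : Γ.graph.dist x y + R ≤ S) : Γ.ball y R ⊆ Γ.ball x S := by
  intro z hz
  rw [mem_ball] at hz ⊢
  have : (Γ.graph.dist x z : ℝ) ≤ Γ.graph.dist x y + Γ.graph.dist y z := by
    exact_mod_cast Γ.graph_connected.dist_triangle (u := x) (v := y) (w := z)
  linarith

theorem F_ne_top (hp : Γ.ControlledWeights) (R : ℝ) : Γ.F R ≠ ⊤ :=
  ((iInf_le (fun x => Γ.E x R) (Classical.arbitrary V)).trans_lt
    (meanExit_ne_top (Γ.finite_setOf_adj hp) (Γ.finite_ball hp _ R) _).lt_top).ne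

theorem toReal_F_le (hp : Γ.ControlledWeights) {x y : V} {R S : ℝ}
    (h : Γ.graph.dist x y + R ≤ S) : (Γ.F R).toReal ≤ (Γ.meanExit y (Γ.ball x S)).toReal :=
  ENNReal.toReal_mono (meanExit_ne_top (Γ.finite_setOf_adj hp) (Γ.finite_ball hp _ _) _)
    ((iInf_le _ y).trans (Γ.meanExit_mono y (ball_subset_ball h)))

theorem green_pos {V : Type*} [Infinite V] {Γ : WeightedGraph V} [DecidableEq V]
    (hp : Γ.ControlledWeights) {x : V} {R : ℝ} (hR : 0 < R) {g : V → V → ℝ}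
    (hg0 : ∀ a b, 0 ≤ g a b) (hg : ∀ a ∈ Γ.ball x R, Γ.avg (fun c => g c x) a +
      (if a = x then (Γ.mass a)⁻¹ else 0) = g a x) {z : V}
    (hz : z ∈ Γ.ball x R) : 0 < g z x := by
  have hΓ := Γ.finite_setOf_adj hp
  obtain ⟨p₀, hp0, hp⟩ := hp
  have hsuper : ∀ a ∈ Γ.ball x R, Γ.avg (fun c => g c x) a ≤ g a x := fun a ha => by
    have h := hg a ha
    have h2 : 0 ≤ if a = x then (Γ.mass a)⁻¹ else 0 := by
      split_ifs
      · exact (inv_pos.2 (Γ.mass_pos a)).le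
      · exact le_rfl
    linarith
  have key : ∀ n z, Γ.graph.dist x z = n → (n : ℝ) < R → 0 < g z x := by
    intro n
    induction n with
    | zero =>
      intro z hz hn
      obtain rfl := Γ.graph_connected.dist_eq_zero_iff.1 hz
      have h := hg x (by simpa [mem_ball] using hR)
      rw [if_pos rfl] at h
      have h1 := inv_pos.2 (Γ.mass_pos x)
      have h2 : 0 ≤ Γ.avg (fun c => g c x) x :=
        tsum_nonneg fun y => mul_nonneg (Γ.P_nonneg x y) (hg0 y x)
      linarith
    | succ n ih =>
      intro z hz hn
      obtain ⟨c, h1, h2⟩ := Γ.exists_dist_eq (a := x) (b := z) (k := n) (by omega)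
      have hc := ih c h1 (by push_cast at hn; linarith)
      refine lt_of_lt_of_le (mul_pos hp0 hc) (mul_le_of_adj hΓ hp (f := fun c => g c x)
        (fun c => hg0 c x) (Γ.adj_of_graph_adj (SimpleGraph.dist_eq_one_iff_adj.1 (by omega)))
        (hsuper z ?_))
      rw [mem_ball, hz]
      exact hn
  exact key _ z rfl hz

theorem exists_three_lt_mul_F_le (hp : Γ.ControlledWeights) (hH : Γ.Harnack) :
    ∃ B : ℝ, 3 < B ∧ ∀ R : ℕ, 1 ≤ R → ENNReal.ofReal B * Γ.F R ≤ Γ.F (3 * (R : ℝ)) := by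
  classical
  have hΓ := Γ.finite_setOf_adj hp
  obtain ⟨C, hC1, hC⟩ := green_comparison hp hH
  have hC0 : 0 < C := zero_lt_one.trans_le hC1
  refine ⟨3 + 2 / C, by linarith [div_pos two_pos hC0], fun R hR => le_iInf fun x => ?_⟩
  have hR1 : (1 : ℝ) ≤ R := by exact_mod_cast hR
  let F := (Γ.F R).toReal
  have hF0 : 0 ≤ F := ENNReal.toReal_nonneg
  let U := Γ.ball x (3 * (R : ℝ))
  have hU : U.Finite := Γ.finite_ball hp _ _
  let u : V → ℝ := fun y => (Γ.meanExit y U).toReal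
  suffices h : (3 + 2 / C) * F ≤ u x by
    rw [← ENNReal.ofReal_toReal (F_ne_top hp (R : ℝ)), ← ENNReal.ofReal_mul (by positivity)]
    exact (ENNReal.ofReal_le_iff_le_toReal (meanExit_ne_top hΓ hU x)).2 h
  have tri := fun u v w => Γ.graph_connected.dist_triangle (u := u) (v := v) (w := w)
  have self_mem : ∀ (p : V) (n : ℕ), 1 ≤ n → p ∈ Γ.ball p n := fun p n hn => by
    rw [mem_ball, SimpleGraph.dist_self]
    exact_mod_cast hn
  have two : ∀ p, 2 * F ≤ (Γ.meanExit p (Γ.ball p (2 * (R : ℝ)))).toReal := fun p => by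
    have h1 : F ≤ (Γ.meanExit p (Γ.ball p R)).toReal := toReal_F_le hp (by simp)
    have h2 := toReal_meanExit_add_le hΓ (A := Γ.ball p R) (B := Γ.ball p (2 * (R : ℝ)))
      (Γ.finite_ball hp _ _) (ball_subset_ball (by simp; linarith)) (m := F)
      (fun a ha y hy hay => toReal_F_le hp (by rw [dist_eq_of_adj_ball ha hy hay]; linarith))
      (self_mem p R hR)
    linarith
  have u_two : ∀ p, Γ.graph.dist x p ≤ R → 2 * F ≤ u p := fun p hpx => by
    refine (two p).trans (ENNReal.toReal_mono (meanExit_ne_top hΓ hU p)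
      (Γ.meanExit_mono p (ball_subset_ball ?_)))
    have : (Γ.graph.dist x p : ℝ) ≤ R := by exact_mod_cast hpx
    linarith
  obtain ⟨g, hsymm, hg0, hgU, hg⟩ := exists_green hΓ hU
  have hx : x ∈ U := by
    simp only [U, mem_ball, SimpleGraph.dist_self, Nat.cast_zero]
    positivity
  have main : ∀ z, Γ.graph.dist x z = 2 * R → (1 + 2 / C) * F ≤ u z := by
    intro z hz
    have hzR : (Γ.graph.dist x z : ℝ) = 2 * R := by exact_mod_cast hz
    have hzU : z ∈ U := by
      simp only [U, mem_ball]
      linarith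
    have gz : 0 < g z x := green_pos hp (R := 3 * (R : ℝ)) (by positivity) hg0
      (fun a ha => by rw [← hg a ha x hx]; ring) hzU
    have harm : ∀ a ∈ U, a ≠ x → Γ.avg (fun c => g c x) a = g a x := fun a ha hax => by
      have h := hg a ha x hx
      rw [if_neg hax] at h
      linarith
    have comparison : ∀ y, Γ.graph.dist x y + 1 = R → g y x ≤ C * g z x := fun y hy =>
      hC x R g hR hsymm hg0 (fun a ha b hb hab => by
        have h := hg a ha b hb
        rw [if_neg hab] at h
        linarith) y z hy hz
    let t := 2 * F / (C * g z x)
    have ht : 0 ≤ t := by positivity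
    have ne_x : ∀ a, R ≤ Γ.graph.dist x a → a ≠ x := by
      rintro a ha rfl
      rw [SimpleGraph.dist_self] at ha
      omega
    have outer : ∀ a, R ≤ Γ.graph.dist x a → 0 ≤ 1 * u a + (-t) * g a x + 0 := by
      intro a ha
      by_cases haU : a ∈ U
      · refine nonneg_of_avg_le (f := fun a => 1 * u a + (-t) * g a x + 0) hΓ
          (A := {a | a ∈ U ∧ R ≤ Γ.graph.dist x a}) (hU.subset fun _ h => h.1)
          (fun b hb => ?_) (fun b hb y hy hby => ?_) ⟨haU, ha⟩
        · rw [avg_const_mul_add hΓ, harm b hb.1 (ne_x b hb.2)]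
          have := toReal_meanExit_of_mem hΓ hU hb.1
          simp only [u]
          linarith
        · by_cases hyU : y ∈ U
          · have hyR : Γ.graph.dist x y < R := not_le.1 fun h => hy ⟨hyU, h⟩
            have h1 := Γ.dist_le_one_of_adj hby.symm'
            have h2 := tri x y b
            have h3 := hb.2
            have h4 := comparison y (by omega)
            have h5 : t * g y x ≤ 2 * F := by
              calc t * g y x ≤ t * (C * g z x) := by gcongr
                _ = 2 * F := div_mul_cancel₀ _ (by positivity)
            have h6 := u_two y hyR.le
            linarith
          · simp only [u, toReal_meanExit_of_notMem hyU, hgU y hyU x]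
            simp
      · simp only [u, toReal_meanExit_of_notMem haU, hgU a haU x]
        simp
    have far : ∀ b, Γ.graph.dist z b ≤ R → R ≤ Γ.graph.dist x b := fun b hb => by
      have h1 := tri x b z
      rw [Γ.graph.dist_comm (u := b)] at h1
      omega
    have zfin : (Γ.ball z R).Finite := Γ.finite_ball hp _ _
    have inner : 0 ≤ 1 * (1 * u z + (-t) * g z x + 0) +
        (-1) * (Γ.meanExit z (Γ.ball z R)).toReal + 0 := by
      refine nonneg_of_avg_le (f := fun a => 1 * (1 * u a + (-t) * g a x + 0) +
        (-1) * (Γ.meanExit a (Γ.ball z R)).toReal + 0) hΓ zfin (fun b hb => ?_)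
        (fun b hb y hy hby => ?_) (self_mem z R hR)
      · have hbR : Γ.graph.dist z b ≤ R := by
          rw [mem_ball] at hb
          exact_mod_cast hb.le
        have hbU : b ∈ U := ball_subset_ball (by linarith) hb
        rw [avg_const_mul_add hΓ, avg_const_mul_add hΓ, harm b hbU (ne_x b (far b hbR))]
        have h1 := toReal_meanExit_of_mem hΓ hU hbU
        have h2 := toReal_meanExit_of_mem hΓ zfin hb
        simp only [u]
        linarith
      · have := outer y (far y (dist_eq_of_adj_ball hb hy hby).le)
        rw [toReal_meanExit_of_notMem hy]
        linarith
    have h1 : F ≤ (Γ.meanExit z (Γ.ball z R)).toReal := toReal_F_le hp (by simp)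
    have h2 : t * g z x = 2 / C * F := by
      simp only [t]
      field_simp
    linarith
  have hcast : ((2 * R : ℕ) : ℝ) = 2 * R := by push_cast; rfl
  have h := toReal_meanExit_add_le hΓ (A := Γ.ball x (2 * R : ℕ)) (B := U) hU
    (ball_subset_ball (by rw [hcast]; simp; linarith)) (m := (1 + 2 / C) * F)
    (fun a ha y hy hay => main y (dist_eq_of_adj_ball ha hy hay)) (self_mem x (2 * R) (by omega))
  rw [hcast] at h
  linarith [two x]

theorem F_mono {V : Type*} [Nontrivial V] [MeasurableSpace V] [DiscreteMeasurableSpace V]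
    {Γ : WeightedGraph V} {R S : ℝ} (h : R ≤ S) : Γ.F R ≤ Γ.F S :=
  iInf_mono fun x => Γ.meanExit_mono x fun _ hy => lt_of_lt_of_le hy h

/-- Anti-doubling along integer radii iterates to anti-doubling along real radii. -/
theorem exists_antiDoubling_of_nat {V : Type*} [Infinite V] [MeasurableSpace V]
    [DiscreteMeasurableSpace V] {Γ : WeightedGraph V} {B : ℝ} (hB : 3 < B)
    (h : ∀ R : ℕ, 1 ≤ R → ENNReal.ofReal B * Γ.F R ≤ Γ.F (3 * (R : ℝ))) :
    ∃ A B : ℝ, 1 < A ∧ A < B ∧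
      ∀ R : ℝ, 1 ≤ R → ENNReal.ofReal B * Γ.F R ≤ Γ.F (A * R) := by
  have hB0 : 0 ≤ B := by linarith
  obtain ⟨k, hk⟩ := pow_unbounded_of_one_lt 2 ((one_lt_div (by norm_num : (0 : ℝ) < 3)).2 hB)
  rw [div_pow, lt_div_iff₀ (by positivity)] at hk
  have iter : ∀ (k n : ℕ), 1 ≤ n →
      ENNReal.ofReal (B ^ k) * Γ.F n ≤ Γ.F ((3 : ℝ) ^ k * n) := by
    intro k n hn
    induction k with
    | zero => simp
    | succ k ih =>
      have h1 := h (3 ^ k * n) (Nat.one_le_iff_ne_zero.2 (by positivity))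
      push_cast at h1
      calc ENNReal.ofReal (B ^ (k + 1)) * Γ.F n
          = ENNReal.ofReal B * (ENNReal.ofReal (B ^ k) * Γ.F n) := by
            rw [pow_succ', ENNReal.ofReal_mul hB0, mul_assoc]
        _ ≤ ENNReal.ofReal B * Γ.F ((3 : ℝ) ^ k * n) := by gcongr
        _ ≤ Γ.F (3 * ((3 : ℝ) ^ k * n)) := h1
        _ = Γ.F ((3 : ℝ) ^ (k + 1) * n) := by rw [pow_succ', mul_assoc]
  refine ⟨2 * 3 ^ k, B ^ k, ?_, hk, fun R hR => ?_⟩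
  · have : (1 : ℝ) ≤ 3 ^ k := one_le_pow₀ (by norm_num)
    linarith
  · have h1 := Nat.le_ceil R
    have h2 := Nat.ceil_lt_add_one (zero_le_one.trans hR)
    calc ENNReal.ofReal (B ^ k) * Γ.F R ≤ ENNReal.ofReal (B ^ k) * Γ.F (⌈R⌉₊ : ℝ) := by
          gcongr
          exact F_mono h1
      _ ≤ Γ.F ((3 : ℝ) ^ k * ⌈R⌉₊) := iter k _ (Nat.one_le_ceil_iff.2 (by linarith))
      _ ≤ Γ.F (2 * 3 ^ k * R) := F_mono (by
          have : (0 : ℝ) < 3 ^ k := by positivity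
          nlinarith)

end AntiDoubling

end WeightedGraph

theorem mainTheorem6 {V : Type*} [Countable V] [Infinite V] [MeasurableSpace V]
    [DiscreteMeasurableSpace V] (Γ : WeightedGraph V)
    (hp : Γ.ControlledWeights) (hVD : Γ.VolumeDoubling) (hE : Γ.HomogeneousExit)
    (hH : Γ.Harnack) :
    (∃ A B : ℝ, 1 < A ∧ A < B ∧
      ∀ R : ℝ, 1 ≤ R → ENNReal.ofReal B * Γ.F R ≤ Γ.F (A * R)) ∧
    (∃ B : ℝ, 3 < B ∧
      ∀ R : ℕ, 1 ≤ R → ENNReal.ofReal B * Γ.F (R : ℝ) ≤ Γ.F (3 * (R : ℝ))) := by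
  obtain ⟨B, hB, h⟩ := WeightedGraph.exists_three_lt_mul_F_le hp hH
  exact ⟨WeightedGraph.exists_antiDoubling_of_nat hB h, B, hB, h⟩
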